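/- Let $(\xi_k)_{k\in\mathbb Z}$ be identically distributed real random variables on a probability space that form a sequence of martingale differences adapted to a filtration $(\mathcal F_k)_{k\in\mathbb Z}$: each $\xi_k$ is $\mathcal F_k$-measurable and integrable, and $\mathbb E(\xi_k\mid\mathcal F_{k-1})=0$ a.s. Put $H_0(x)=\mathbb E\big(\xi_0^2 I(|\xi_0|\le x)\big)$ and assume that $\mathbb E(\xi_0^2)=\infty$ and that (DA) $H_0$ is slowly varying at $\infty$, i.e. $H_0(tx)/H_0(x)\to1$ as $x\to\infty$ for every $t>0$. Let $b=\inf\{x\ge 0: H_0(x)>1\}$, $H(x)=H_0(\max(x,b+1))$ (so that $H\ge 1$, and $H=H_0$ on $[b+1,\infty)$), and $$D_n=\inf\Big\{s\ge1:\ \frac{n}{s^2}H(s)\le 1\Big\},\qquad M_n=\sum_{k=1}^n\xi_k .$$ (i) If $$\frac1{D_n^2}\sum_{k=1}^n\xi_k^2\to 1\quad\text{in probability as } n\to\infty, \tag{$*$}$$ then $M_n/D_n$ converges in distribution to the standard normal law $N(0,1)$ as $n\to\infty$. (ii) Condition $(*)$ holds if one of the following two conditions is satisfied: ($M_1$) there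 is a sequence of positive numbers $\psi_k\to0$ such that for all $a,b>0$, all integers $j$ and all integers $k\ge1$, $$\operatorname{cov}\big(\xi_j^2I(|\xi_j|\le a),\,\xi_{j+k}^2I(|\xi_{j+k}|\le b)\big)\le\psi_k\,\mathbb E\big(\xi_0^2I(|\xi_0|\le b)\big)\,\mathbb E\big(\xi_0^2I(|\xi_0|\le a)\big);$$ ($M_2$) there is a sequence of positive numbers $\varphi_k$ with $\sum_{k\ge1}\varphi_k<\infty$ such that for all $a,b>0$, all integers $j$ and all integers $k\ge1$, $$\operatorname{cov}\big(\xi_j^2I(|\xi_j|\le a),\,\xi_{j+k}^2I(|\xi_{j+k}|\le b)\big)\le a^2\varphi_k\,\mathbb E\big(\xi_0^2I(|\xi_0|\le b)\big).$$ -/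

import Mathlib

open MeasureTheory ProbabilityTheory Filter Topology

namespace InfVarMart

/-- `f` is slowly varying at infinity. -/
def SlowlyVarying (f : ℝ → ℝ) : Prop :=
  Measurable f ∧ (∀ᶠ x in atTop, 0 < f x) ∧
    ∀ t : ℝ, 0 < t → Tendsto (fun x => f (t * x) / f x) atTop (𝓝 1)

/-- The truncated square `X² I(|X| ≤ a)`. -/
noncomputable def truncSq {Ω : Type*} (X : Ω → ℝ) (a : ℝ) : Ω → ℝ :=
  Set.indicator {ω | |X ω| ≤ a} (fun ω => X ω ^ 2)

/-- The truncated second moment `E (X² I(|X| ≤ x))`, as a function of `x`. -/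
noncomputable def truncMoment {Ω : Type*} [MeasurableSpace Ω] (μ : Measure Ω) (X : Ω → ℝ)
    (x : ℝ) : ℝ :=
  ∫ ω, truncSq X x ω ∂μ

/-- `(ξ_k)` is a sequence of martingale differences adapted to the filtration `ℱ`. -/
structure IsMartingaleDifference {Ω : Type*} {m : MeasurableSpace Ω} (μ : Measure Ω)
    (ℱ : Filtration ℤ m) (ξ : ℤ → Ω → ℝ) : Prop where
  adapted : Adapted ℱ ξ
  integrable : ∀ k, Integrable (ξ k) μ
  condExp_eq_zero : ∀ k, μ[ξ k | ℱ (k - 1)] =ᵐ[μ] 0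

/-- The level `b = inf {x ≥ 0 : E (X² I(|X| ≤ x)) > 1}`. -/
noncomputable def cutLevel {Ω : Type*} [MeasurableSpace Ω] (μ : Measure Ω) (X : Ω → ℝ) : ℝ :=
  sInf {x : ℝ | 0 ≤ x ∧ 1 < truncMoment μ X x}

/-- The modified truncated second moment `H (x) = E (X² I(|X| ≤ max x (b + 1)))`. -/
noncomputable def modMoment {Ω : Type*} [MeasurableSpace Ω] (μ : Measure Ω) (X : Ω → ℝ)
    (x : ℝ) : ℝ :=
  truncMoment μ X (max x (cutLevel μ X + 1))

/-- The normalizer `D_n = inf {s ≥ 1 : (n / s²) H (s) ≤ 1}`. -/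
noncomputable def normalizer {Ω : Type*} [MeasurableSpace Ω] (μ : Measure Ω) (X : Ω → ℝ)
    (n : ℕ) : ℝ :=
  sInf {s : ℝ | 1 ≤ s ∧ (n : ℝ) / s ^ 2 * modMoment μ X s ≤ 1}

/-- The pairwise mixing condition `(M₁)`. -/
def MixingOne {Ω : Type*} [MeasurableSpace Ω] (μ : Measure Ω) (ξ : ℤ → Ω → ℝ) : Prop :=
  ∃ ψ : ℕ → ℝ, (∀ k, 0 < ψ k) ∧ Tendsto ψ atTop (𝓝 0) ∧
    ∀ a b : ℝ, 0 < a → 0 < b → ∀ (j : ℤ) (k : ℕ), 1 ≤ k →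
      cov[truncSq (ξ j) a, truncSq (ξ (j + k)) b; μ] ≤
        ψ k * truncMoment μ (ξ 0) b * truncMoment μ (ξ 0) a

/-- The pairwise mixing condition `(M₂)`. -/
def MixingTwo {Ω : Type*} [MeasurableSpace Ω] (μ : Measure Ω) (ξ : ℤ → Ω → ℝ) : Prop :=
  ∃ φ : ℕ → ℝ, (∀ k, 0 < φ k) ∧ Summable φ ∧
    ∀ a b : ℝ, 0 < a → 0 < b → ∀ (j : ℤ) (k : ℕ), 1 ≤ k →
      cov[truncSq (ξ j) a, truncSq (ξ (j + k)) b; μ] ≤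
        a ^ 2 * φ k * truncMoment μ (ξ 0) b

/-- `D_n⁻² ∑_{k=1}^n ξ_k²` converges to `1` in probability. -/
def SquaresConverge {Ω : Type*} [MeasurableSpace Ω] (μ : Measure Ω) (ξ : ℤ → Ω → ℝ) : Prop :=
  TendstoInMeasure μ
    (fun (n : ℕ) ω => 1 / normalizer μ (ξ 0) n ^ 2 * ∑ k ∈ Finset.Icc (1 : ℤ) n, ξ k ω ^ 2)
    atTop (fun _ => (1 : ℝ))

end InfVarMart

/-! Part (i) is a McLeish-type argument that uses only first moments of the increments. For a row
`X_k = t ξ_{k+1} / D_n` the product `∏ (1 + i X_k)` has mean one by the martingale property, and it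
agrees with `exp (i ∑ X_k + ∑ X_k² / 2)` up to a cubic error when all `|X_k|` are small. If `∑ X_k²`
is close to `t²`, this forces `E exp (i ∑ X_k)` towards `exp (-t² / 2)`. Since the variance is
infinite, the product is stopped once the running sum of squares exceeds a level `c`; each new
increment is then an integrable variable times a bounded predictable one
(`integrable_stoppedProd_and_integral`). `norm_integral_exp_sub_le` turns this into an explicit
bound whose random errors are the probability that the squares miss `t²` and the expected sum of the
large `|X_k|`.

That last sum is handled by slow variation: `n H(D_n) = D_n²` together with Karamata's `x E(|ξ_0|
I(|ξ_0| > x)) = o(H_0(x))` gives `n E(|ξ_0| I(|ξ_0| > ε D_n)) = o(D_n)`.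

Part (ii) is a weak law by truncation at `ε D_n`. The same tail estimate makes truncation harmless,
slow variation puts the truncated mean at `D_n²`, and both mixing conditions imply
`CovarianceDecay`, which bounds the variance by a small multiple of `D_n⁴`, so Chebyshev applies. -/

namespace InfVarMart

/-! ### Pathwise comparison of `exp (i ∑ x_k)` with the stopped product. -/

section Deterministic

/-- The product `∏ (1 + i x_k)` over `k < n`, whose factors are replaced by `1` as soon as the
preceding partial sum of squares exceeds `c`. -/
noncomputable def stoppedProd (c : ℝ) (x : ℕ → ℝ) (n : ℕ) : ℂ :=
  ∏ k ∈ Finset.range n,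
    (1 + ((if ∑ j ∈ Finset.range k, x j ^ 2 ≤ c then x k else 0 : ℝ) : ℂ) * Complex.I)

lemma norm_one_add_mul_I_le (x : ℝ) : ‖(1 + x * Complex.I : ℂ)‖ ≤ Real.exp (x ^ 2 / 2) := by
  have h1 : ‖(1 + x * Complex.I : ℂ)‖ ^ 2 = 1 + x ^ 2 := by
    rw [← Complex.normSq_eq_norm_sq, Complex.normSq_apply]
    simp
    ring
  refine le_of_sq_le_sq ?_ (Real.exp_pos _).le
  rw [h1, ← Real.exp_nat_mul]
  have h2 : ((2 : ℕ) : ℝ) * (x ^ 2 / 2) = x ^ 2 := by push_cast; ring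
  rw [h2]
  linarith [Real.add_one_le_exp (x ^ 2)]

/-- The term `x² / 2` cancels the quadratic term of `exp (i x)`, so only a cubic error remains. -/
lemma norm_exp_sub_one_add_mul_I_le {x : ℝ} (hx : |x| ≤ 1 / 2) :
    ‖Complex.exp (x * Complex.I + x ^ 2 / 2) - (1 + x * Complex.I)‖ ≤ 7 * |x| ^ 3 := by
  set z : ℂ := x * Complex.I + x ^ 2 / 2 with hz
  have h0 := abs_nonneg x
  have hzn : ‖z‖ ≤ 5 / 4 * |x| := by
    calc ‖z‖ ≤ ‖(x * Complex.I : ℂ)‖ + ‖((x : ℂ) ^ 2 / 2)‖ := norm_add_le _ _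
      _ = |x| + |x| ^ 2 / 2 := by simp
      _ ≤ 5 / 4 * |x| := by nlinarith
  have hz1 : ‖z‖ ≤ 1 := by linarith
  have h1 := Complex.norm_exp_sub_sum_le_norm_mul_exp z 3
  have h2 : Real.exp ‖z‖ ≤ 2.7182818286 :=
    (Real.exp_le_exp.2 hz1).trans Real.exp_one_lt_d9.le
  have h3 : ‖z‖ ^ 3 * Real.exp ‖z‖ ≤ (5 / 4 * |x|) ^ 3 * 2.7182818286 := by gcongr
  -- `1 + z + z² / 2 = 1 + i x + i x³ / 2 + x⁴ / 8`; the constant 7 exceeds `(5/4)³ e + 1`.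
  have h4 : Complex.exp z - (1 + x * Complex.I) =
      (Complex.exp z - ∑ m ∈ Finset.range 3, z ^ m / (m.factorial : ℂ)) +
        ((x : ℂ) ^ 3 / 2 * Complex.I + (x : ℂ) ^ 4 / 8) := by
    simp only [Finset.sum_range_succ, Finset.sum_range_zero, Nat.factorial, hz]
    push_cast
    ring_nf
    simp only [Complex.I_sq]
    ring
  have h5 : ‖((x : ℂ) ^ 3 / 2 * Complex.I + (x : ℂ) ^ 4 / 8)‖ ≤ |x| ^ 3 := by
    calc _ ≤ ‖((x : ℂ) ^ 3 / 2 * Complex.I)‖ + ‖((x : ℂ) ^ 4 / 8)‖ := norm_add_le _ _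
      _ = |x| ^ 3 / 2 + |x| ^ 3 * |x| / 8 := by simp; ring
      _ ≤ |x| ^ 3 := by nlinarith [pow_nonneg h0 3]
  rw [h4]
  refine (norm_add_le _ _).trans ?_
  have := pow_nonneg h0 3
  nlinarith

lemma norm_prod_sub_prod_le_sum {a b : ℕ → ℂ} {M : ℕ → ℝ} (n : ℕ) (hM : ∀ k, 1 ≤ M k)
    (ha : ∀ k, ‖a k‖ ≤ M k) (hb : ∀ k, ‖b k‖ ≤ M k) :
    ‖∏ k ∈ Finset.range n, a k - ∏ k ∈ Finset.range n, b k‖ ≤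
      (∑ k ∈ Finset.range n, ‖a k - b k‖) * ∏ k ∈ Finset.range n, M k := by
  have hM0 : ∀ k, 0 ≤ M k := fun k => zero_le_one.trans (hM k)
  induction n with
  | zero => simp
  | succ n ih =>
    rw [Finset.prod_range_succ, Finset.prod_range_succ, Finset.prod_range_succ,
      Finset.sum_range_succ]
    set A := ∏ k ∈ Finset.range n, a k
    set B := ∏ k ∈ Finset.range n, b k
    set P := ∏ k ∈ Finset.range n, M k
    have hP : 0 ≤ P := Finset.prod_nonneg fun k _ => hM0 k
    have hB : ‖B‖ ≤ P := by
      simp only [B, P, norm_prod]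
      exact Finset.prod_le_prod (fun _ _ => norm_nonneg _) fun k _ => hb k
    have : A * a n - B * b n = (A - B) * a n + B * (a n - b n) := by ring
    rw [this]
    calc _ ≤ ‖A - B‖ * ‖a n‖ + ‖B‖ * ‖a n - b n‖ := by
            refine (norm_add_le _ _).trans ?_
            rw [norm_mul, norm_mul]
      _ ≤ ((∑ k ∈ Finset.range n, ‖a k - b k‖) * P) * M n + (P * M n) * ‖a n - b n‖ := by
            have h1 : ‖B‖ ≤ P * M n := hB.trans (le_mul_of_one_le_right hP (hM n))
            have h2 : 0 ≤ ∑ k ∈ Finset.range n, ‖a k - b k‖ :=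
              Finset.sum_nonneg fun _ _ => norm_nonneg _
            have h3 := ha n
            gcongr
      _ = _ := by ring

/-- Telescoping the two products costs a factor `exp (V / 2)`, with `V` the sum of squares; the
weight `exp (-V / 2)` cancels it exactly. -/
lemma norm_exp_sub_prod_mul_exp_le {x : ℕ → ℝ} {n : ℕ} {η : ℝ} (hη : η ≤ 1 / 2)
    (hx : ∀ k < n, |x k| ≤ η) :
    ‖Complex.exp ((∑ k ∈ Finset.range n, x k : ℝ) * Complex.I) -
        (∏ k ∈ Finset.range n, (1 + x k * Complex.I)) *
          Real.exp (-(∑ k ∈ Finset.range n, x k ^ 2) / 2)‖ ≤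
      7 * η * ∑ k ∈ Finset.range n, x k ^ 2 := by
  set V := ∑ k ∈ Finset.range n, x k ^ 2 with hV
  set a : ℕ → ℂ := fun k => Complex.exp (x k * Complex.I + (x k) ^ 2 / 2)
  have hM : ∀ k, 1 ≤ Real.exp (x k ^ 2 / 2) := fun k => Real.one_le_exp (by positivity)
  have ha : ∀ k, ‖a k‖ ≤ Real.exp (x k ^ 2 / 2) := by
    intro k
    simp only [a, Complex.norm_exp]
    refine le_of_eq ?_
    congr 1
    have : ((x k : ℂ) ^ 2 / 2) = ((x k ^ 2 / 2 : ℝ) : ℂ) := by push_cast; ring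
    rw [this, Complex.add_re, Complex.re_ofReal_mul, Complex.ofReal_re]
    simp
  have h1 := norm_prod_sub_prod_le_sum (a := a) (b := fun k => 1 + x k * Complex.I) n hM ha
    (fun k => norm_one_add_mul_I_le _)
  have hprodM : ∏ k ∈ Finset.range n, Real.exp (x k ^ 2 / 2) = Real.exp (V / 2) := by
    rw [← Real.exp_sum, ← Finset.sum_div]
  have hproda : ∏ k ∈ Finset.range n, a k =
      Complex.exp ((∑ k ∈ Finset.range n, x k : ℝ) * Complex.I) * (Real.exp (V / 2) : ℂ) := by
    simp only [a]
    rw [← Complex.exp_sum, Complex.ofReal_exp, ← Complex.exp_add, Finset.sum_add_distrib,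
      ← Finset.sum_mul, ← Finset.sum_div]
    simp [hV]
  have h2 : ∑ k ∈ Finset.range n, ‖a k - (1 + x k * Complex.I)‖ ≤ 7 * η * V := by
    rw [hV, Finset.mul_sum]
    refine Finset.sum_le_sum fun k hk => ?_
    have hk' := hx k (Finset.mem_range.1 hk)
    refine (norm_exp_sub_one_add_mul_I_le (hk'.trans hη)).trans ?_
    rw [← sq_abs (x k)]
    nlinarith [sq_nonneg |x k|]
  have hexp : (Real.exp (V / 2) : ℂ) * (Real.exp (-V / 2) : ℂ) = 1 := by
    rw [← Complex.ofReal_mul, ← Real.exp_add]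
    norm_num [neg_div]
  have h3 : Complex.exp ((∑ k ∈ Finset.range n, x k : ℝ) * Complex.I) -
        (∏ k ∈ Finset.range n, (1 + x k * Complex.I)) * Real.exp (-V / 2) =
      (∏ k ∈ Finset.range n, a k - ∏ k ∈ Finset.range n, (1 + x k * Complex.I)) *
        Real.exp (-V / 2) := by
    rw [hproda, sub_mul, mul_assoc, hexp, mul_one]
  rw [h3, norm_mul, Complex.norm_real, Real.norm_of_nonneg (Real.exp_pos _).le]
  calc _ ≤ (7 * η * V * Real.exp (V / 2)) * Real.exp (-V / 2) := by
          rw [hprodM] at h1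
          gcongr
          exact h1.trans (by gcongr)
    _ = 7 * η * V := by
          rw [mul_assoc, ← Real.exp_add]
          norm_num [neg_div]

lemma stoppedProd_eq_prod {c : ℝ} {x : ℕ → ℝ} {n : ℕ}
    (h : ∑ j ∈ Finset.range n, x j ^ 2 ≤ c) :
    stoppedProd c x n = ∏ k ∈ Finset.range n, (1 + x k * Complex.I) := by
  refine Finset.prod_congr rfl fun k hk => ?_
  rw [if_pos]
  refine le_trans ?_ h
  exact Finset.sum_le_sum_of_subset_of_nonneg
    (Finset.range_subset_range.2 (Finset.mem_range.1 hk).le) fun _ _ _ => sq_nonneg _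

lemma norm_stoppedProd_le_of_sum_le {c : ℝ} {x : ℕ → ℝ} {n : ℕ}
    (h : ∑ j ∈ Finset.range n, x j ^ 2 ≤ c) : ‖stoppedProd c x n‖ ≤ Real.exp (c / 2) := by
  rw [stoppedProd_eq_prod h, norm_prod]
  calc _ ≤ ∏ k ∈ Finset.range n, Real.exp (x k ^ 2 / 2) :=
        Finset.prod_le_prod (fun _ _ => norm_nonneg _) fun k _ => norm_one_add_mul_I_le _
    _ = Real.exp ((∑ j ∈ Finset.range n, x j ^ 2) / 2) := by
        rw [← Real.exp_sum, ← Finset.sum_div]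
    _ ≤ _ := by gcongr

lemma stoppedProd_succ (c : ℝ) (x : ℕ → ℝ) (n : ℕ) :
    stoppedProd c x (n + 1) = stoppedProd c x n +
      x n • (if ∑ j ∈ Finset.range n, x j ^ 2 ≤ c then stoppedProd c x n * Complex.I else 0) := by
  rw [stoppedProd, Finset.prod_range_succ, ← stoppedProd, Complex.real_smul]
  split_ifs <;> push_cast <;> ring

/-- Factors before the crossing of `c` contribute at most `exp (c / 2)`, the crossing factor at most
`1 + ρ`, and all later ones equal 1. -/
lemma norm_stoppedProd_le {c : ℝ} (hc : 0 ≤ c) {x : ℕ → ℝ} {n : ℕ} {ρ : ℝ} (hρ : 0 ≤ ρ)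
    (h : ∀ k < n, |x k| ≤ ρ) : ‖stoppedProd c x n‖ ≤ Real.exp (c / 2) * (1 + ρ) := by
  induction n with
  | zero =>
    have := Real.one_le_exp (show 0 ≤ c / 2 by positivity)
    simp [stoppedProd]
    nlinarith
  | succ n ih =>
    rw [stoppedProd_succ]
    split_ifs with hs
    · have h1 := norm_stoppedProd_le_of_sum_le hs
      have h2 := h n n.lt_succ_self
      calc _ ≤ ‖stoppedProd c x n‖ + |x n| * ‖stoppedProd c x n‖ := by
              refine (norm_add_le _ _).trans ?_
              rw [norm_smul]
              simp
        _ ≤ Real.exp (c / 2) + ρ * Real.exp (c / 2) := by gcongr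
        _ = _ := by ring
    · simpa using ih fun k hk => h k (hk.trans n.lt_succ_self)

/-- The sum of the absolute values exceeding the level `η`. -/
noncomputable def tailSum (η : ℝ) (x : ℕ → ℝ) (n : ℕ) : ℝ :=
  ∑ k ∈ Finset.range n, if η < |x k| then |x k| else 0

lemma tailSum_nonneg (η : ℝ) (x : ℕ → ℝ) (n : ℕ) : 0 ≤ tailSum η x n :=
  Finset.sum_nonneg fun k _ => by split_ifs <;> simp

lemma le_tailSum {η : ℝ} {x : ℕ → ℝ} {n k : ℕ} (hk : k < n) (h : η < |x k|) :
    |x k| ≤ tailSum η x n := by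
  have := Finset.single_le_sum (f := fun k => if η < |x k| then |x k| else 0)
    (fun k _ => by split_ifs <;> simp) (Finset.mem_range.2 hk)
  simpa [h, tailSum] using this

lemma abs_le_add_tailSum {η : ℝ} (hη : 0 ≤ η) {x : ℕ → ℝ} {n k : ℕ} (hk : k < n) :
    |x k| ≤ η + tailSum η x n := by
  by_cases h : η < |x k|
  · linarith [le_tailSum hk h]
  · linarith [tailSum_nonneg η x n]

lemma abs_exp_neg_sub_exp_neg_le {a b : ℝ} (ha : 0 ≤ a) (hb : 0 ≤ b) :
    |Real.exp (-a) - Real.exp (-b)| ≤ |a - b| := by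
  wlog h : a ≤ b generalizing a b
  · rw [abs_sub_comm, abs_sub_comm a]
    exact this hb ha (le_of_not_ge h)
  have h1 : Real.exp (-b) ≤ Real.exp (-a) := Real.exp_le_exp.2 (by linarith)
  rw [abs_of_nonneg (by linarith), abs_sub_comm, abs_of_nonneg (by linarith)]
  have h2 : Real.exp (-b) = Real.exp (-a) * Real.exp (-(b - a)) := by
    rw [← Real.exp_add]; congr 1; ring
  have h3 := Real.one_sub_le_exp_neg (b - a)
  have h4 : Real.exp (-a) ≤ 1 := Real.exp_le_one_iff.2 (by linarith)
  have h5 := Real.exp_pos (-a)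
  rw [h2]
  nlinarith

/-- On a good path `v + δ ≤ c` prevents stopping, the cubic estimate applies, and replacing the sum
of squares by `v` costs `exp (c / 2) δ`. On any other path the crude bound suffices, because the
indicator of `bad` plus `tailSum / η` is then at least 1. -/
lemma norm_exp_sub_stoppedProd_mul_exp_le {x : ℕ → ℝ} {n : ℕ} {v c δ η : ℝ} (hv : 0 ≤ v)
    (hη0 : 0 < η) (hη : η ≤ 1 / 2) (hδ0 : 0 ≤ δ) (hc : v + δ ≤ c) (bad : Prop) [Decidable bad]
    (hbad : ¬ bad → |∑ k ∈ Finset.range n, x k ^ 2 - v| ≤ δ) :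
    ‖Complex.exp ((∑ k ∈ Finset.range n, x k : ℝ) * Complex.I) -
        stoppedProd c x n * Real.exp (-v / 2)‖ ≤
      (7 * η * c + Real.exp (c / 2) * δ) +
        (1 + 2 * Real.exp (c / 2)) * ((if bad then 1 else 0) + tailSum η x n / η) +
        Real.exp (c / 2) * tailSum η x n := by
  have hc0 : 0 ≤ c := by linarith
  have hR := tailSum_nonneg η x n
  have hE := Real.exp_pos (c / 2)
  by_cases hgood : ¬ bad ∧ ∀ k < n, |x k| ≤ η
  · obtain ⟨hb, hx⟩ := hgood
    have hV := hbad hb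
    have h1 := norm_exp_sub_prod_mul_exp_le hη hx
    set V := ∑ k ∈ Finset.range n, x k ^ 2
    have hV0 : 0 ≤ V := Finset.sum_nonneg fun _ _ => sq_nonneg _
    have hVc : V ≤ c := by linarith [(abs_le.1 hV).2]
    have h2 := norm_stoppedProd_le_of_sum_le hVc
    rw [← stoppedProd_eq_prod hVc] at h1
    have h3 := abs_exp_neg_sub_exp_neg_le (a := V / 2) (b := v / 2) (by positivity) (by positivity)
    have h4 : |V / 2 - v / 2| ≤ δ := by
      rw [← sub_div, abs_div, abs_two]
      linarith [abs_nonneg (V - v)]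
    have h5 : Complex.exp ((∑ k ∈ Finset.range n, x k : ℝ) * Complex.I) -
          stoppedProd c x n * Real.exp (-v / 2) =
        (Complex.exp ((∑ k ∈ Finset.range n, x k : ℝ) * Complex.I) -
          stoppedProd c x n * Real.exp (-V / 2)) +
        stoppedProd c x n * ((Real.exp (-(V / 2)) - Real.exp (-(v / 2)) : ℝ) : ℂ) := by
      rw [← neg_div, ← neg_div]
      push_cast
      ring
    rw [h5]
    have h6 : 0 ≤ (1 + 2 * Real.exp (c / 2)) * ((if bad then 1 else 0) + tailSum η x n / η) := by
      split_ifs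
      all_goals positivity
    have h7 : 0 ≤ Real.exp (c / 2) * tailSum η x n := by positivity
    calc _ ≤ 7 * η * V + Real.exp (c / 2) * δ := by
            refine (norm_add_le _ _).trans (add_le_add h1 ?_)
            rw [norm_mul, Complex.norm_real, Real.norm_eq_abs]
            exact mul_le_mul h2 (h3.trans h4) (abs_nonneg _) hE.le
      _ ≤ 7 * η * c + Real.exp (c / 2) * δ := by gcongr
      _ ≤ _ := by linarith
  · have h1 : (1 : ℝ) ≤ (if bad then 1 else 0) + tailSum η x n / η := by
      by_cases hb : bad
      · simp only [hb, if_true]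
        have : 0 ≤ tailSum η x n / η := by positivity
        linarith
      · simp only [hb, not_false_eq_true, true_and, not_forall, not_le, exists_prop] at hgood
        obtain ⟨k, hk, hkx⟩ := hgood
        have : 1 ≤ tailSum η x n / η := (one_le_div hη0).2 (hkx.le.trans (le_tailSum hk hkx))
        simpa [hb] using this
    have h2 := norm_stoppedProd_le hc0 (ρ := η + tailSum η x n) (by positivity)
      (fun k hk => abs_le_add_tailSum (x := x) hη0.le hk)
    have h3 : Real.exp (-v / 2) ≤ 1 := Real.exp_le_one_iff.2 (by linarith)
    have h4 : ‖Complex.exp ((∑ k ∈ Finset.range n, x k : ℝ) * Complex.I)‖ = 1 :=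
      Complex.norm_exp_ofReal_mul_I _
    have h5 : 0 ≤ 7 * η * c + Real.exp (c / 2) * δ := by positivity
    calc _ ≤ 1 + Real.exp (c / 2) * (1 + (η + tailSum η x n)) * 1 := by
            refine (norm_sub_le _ _).trans (add_le_add h4.le ?_)
            rw [norm_mul, Complex.norm_real, Real.norm_of_nonneg (Real.exp_pos _).le]
            exact mul_le_mul h2 h3 (Real.exp_pos _).le (by positivity)
      _ ≤ (1 + 2 * Real.exp (c / 2)) * 1 + Real.exp (c / 2) * tailSum η x n := by nlinarith
      _ ≤ (1 + 2 * Real.exp (c / 2)) * ((if bad then 1 else 0) + tailSum η x n / η) +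
            Real.exp (c / 2) * tailSum η x n := by gcongr
      _ ≤ _ := by linarith

end Deterministic

/-! ### Mean-one property and characteristic function bound for one row. -/

section Row

variable {Ω : Type*} {m : MeasurableSpace Ω} {μ : Measure Ω} [IsProbabilityMeasure μ]
  {F : Filtration ℕ m} {X : ℕ → Ω → ℝ}

lemma measurable_stoppedProd (hX : ∀ k, Measurable[F (k + 1)] (X k)) (c : ℝ) (n : ℕ) :
    Measurable[F n] (fun ω => stoppedProd c (fun k => X k ω) n) := by
  have hX' : ∀ k < n, Measurable[F n] (X k) := fun k hk =>
    (hX k).mono (F.mono hk) le_rfl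
  unfold stoppedProd
  refine Finset.measurable_fun_prod _ fun k hk => ?_
  have hk := Finset.mem_range.1 hk
  have hs : Measurable[F n] fun ω => ∑ j ∈ Finset.range k, X j ω ^ 2 :=
    Finset.measurable_fun_sum _ fun j hj => (hX' j ((Finset.mem_range.1 hj).trans hk)).pow_const 2
  have h1 : Measurable[F n]
      fun ω => if ∑ j ∈ Finset.range k, X j ω ^ 2 ≤ c then X k ω else 0 :=
    Measurable.ite (measurableSet_le hs measurable_const) (hX' k hk) measurable_const
  exact measurable_const.add ((Complex.measurable_ofReal.comp h1).mul measurable_const)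

/-- A stopped product of `1 + i X_k`, with `X_k` martingale differences, has mean `1`. -/
lemma integrable_stoppedProd_and_integral (hX : ∀ k, Measurable[F (k + 1)] (X k))
    (hint : ∀ k, Integrable (X k) μ) (hcond : ∀ k, μ[X k | F k] =ᵐ[μ] 0) (c : ℝ) (n : ℕ) :
    Integrable (fun ω => stoppedProd c (fun k => X k ω) n) μ ∧
      ∫ ω, stoppedProd c (fun k => X k ω) n ∂μ = 1 := by
  induction n with
  | zero => simp [stoppedProd]
  | succ n ih =>
    set g : Ω → ℂ := fun ω => if ∑ j ∈ Finset.range n, X j ω ^ 2 ≤ c then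
      stoppedProd c (fun k => X k ω) n * Complex.I else 0 with hg
    have hs : Measurable[F n] fun ω => ∑ j ∈ Finset.range n, X j ω ^ 2 :=
      Finset.measurable_fun_sum _ fun j hj =>
        ((hX j).mono (F.mono (Finset.mem_range.1 hj)) le_rfl).pow_const 2
    have hgm : Measurable[F n] g :=
      Measurable.ite (measurableSet_le hs measurable_const)
        ((measurable_stoppedProd hX c n).mul measurable_const) measurable_const
    have hgb : ∀ ω, ‖g ω‖ ≤ Real.exp (c / 2) := by
      intro ω
      simp only [hg]
      split_ifs with h
      · simpa using norm_stoppedProd_le_of_sum_le h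
      · simpa using (Real.exp_pos _).le
    -- The stopping indicator makes `g` bounded, so integrability of `X n` is enough; no second
    -- moment is needed.
    have hXg : Integrable (X n • g) μ :=
      Integrable.smul_bdd (C := Real.exp (c / 2)) (hint n)
        (hgm.mono (F.le n) le_rfl).aestronglyMeasurable (.of_forall hgb)
    have h0 : ∫ ω, (X n • g) ω ∂μ = 0 := by
      have h1 := condExp_smul_of_aestronglyMeasurable_right (m := F n) (hint n) hXg
        hgm.stronglyMeasurable.aestronglyMeasurable
      rw [← integral_condExp (F.le n)]
      rw [integral_eq_zero_of_ae]
      filter_upwards [h1, hcond n] with ω h1 h2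
      rw [h1]
      simp [h2]
    have heq : (fun ω => stoppedProd c (fun k => X k ω) (n + 1)) =
        fun ω => stoppedProd c (fun k => X k ω) n + (X n • g) ω := by
      ext ω
      rw [stoppedProd_succ]
      rfl
    rw [heq]
    exact ⟨ih.1.add hXg, by rw [integral_add ih.1 hXg, ih.2, h0, add_zero]⟩

omit [IsProbabilityMeasure μ] in
lemma integrable_tailSum (hint : ∀ k, Integrable (X k) μ) (η : ℝ) (n : ℕ) :
    Integrable (fun ω => tailSum η (fun k => X k ω) n) μ := by
  unfold tailSum
  refine integrable_finsetSum _ fun k _ => ?_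
  refine (hint k).abs.mono ?_ (.of_forall fun ω => ?_)
  · have h := (hint k).abs.aestronglyMeasurable.aemeasurable
    have : Measurable fun y : ℝ => if η < y then y else 0 :=
      Measurable.ite (measurableSet_lt measurable_const measurable_id) measurable_id
        measurable_const
    exact (this.comp_aemeasurable h).aestronglyMeasurable
  · split_ifs <;> simp

/-- A quantitative central limit bound for one row of martingale differences. -/
lemma norm_integral_exp_sub_le (hX : ∀ k, Measurable[F (k + 1)] (X k))
    (hint : ∀ k, Integrable (X k) μ) (hcond : ∀ k, μ[X k | F k] =ᵐ[μ] 0) (n : ℕ)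
    {v c δ η : ℝ} (hv : 0 ≤ v) (hη0 : 0 < η) (hη : η ≤ 1 / 2) (hδ0 : 0 ≤ δ) (hc : v + δ ≤ c) :
    ‖∫ ω, Complex.exp ((∑ k ∈ Finset.range n, X k ω : ℝ) * Complex.I) ∂μ -
        Real.exp (-v / 2)‖ ≤
      (7 * η * c + Real.exp (c / 2) * δ) +
        (1 + 2 * Real.exp (c / 2)) *
          (μ.real {ω | δ ≤ |∑ k ∈ Finset.range n, X k ω ^ 2 - v|} +
            (∫ ω, tailSum η (fun k => X k ω) n ∂μ) / η) +
        Real.exp (c / 2) * ∫ ω, tailSum η (fun k => X k ω) n ∂μ := by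
  classical
  have hXm : ∀ k, Measurable (X k) := fun k => (hX k).mono (F.le _) le_rfl
  obtain ⟨hW, hW1⟩ := integrable_stoppedProd_and_integral hX hint hcond c n
  have hR := integrable_tailSum (μ := μ) hint η n
  set B : Set Ω := {ω | δ ≤ |∑ k ∈ Finset.range n, X k ω ^ 2 - v|} with hB
  have hBm : MeasurableSet B := by
    refine measurableSet_le measurable_const ?_
    have : Measurable fun ω => ∑ k ∈ Finset.range n, X k ω ^ 2 - v :=
      (Finset.measurable_fun_sum _ fun k _ => (hXm k).pow_const 2).sub_const v
    exact continuous_abs.measurable.comp this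
  have hE : Integrable
      (fun ω => Complex.exp ((∑ k ∈ Finset.range n, X k ω : ℝ) * Complex.I)) μ := by
    refine Integrable.of_bound (C := 1) ?_ (.of_forall fun ω => ?_)
    · have : Measurable fun ω => ∑ k ∈ Finset.range n, X k ω :=
        Finset.measurable_fun_sum _ fun k _ => hXm k
      exact (Complex.measurable_exp.comp
        ((Complex.measurable_ofReal.comp this).mul_const _)).aestronglyMeasurable
    · exact (Complex.norm_exp_ofReal_mul_I _).le
  -- Since the stopped product has mean 1, the constant `exp (-v / 2)` can be moved inside the
  -- integral as its multiple.
  have h1 : ∫ ω, Complex.exp ((∑ k ∈ Finset.range n, X k ω : ℝ) * Complex.I) ∂μ -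
        Real.exp (-v / 2) =
      ∫ ω, (Complex.exp ((∑ k ∈ Finset.range n, X k ω : ℝ) * Complex.I) -
        stoppedProd c (fun k => X k ω) n * Real.exp (-v / 2)) ∂μ := by
    rw [integral_sub hE (hW.mul_const _), integral_mul_const, hW1, one_mul]
  have hBi : Integrable (B.indicator (fun _ => (1 : ℝ))) μ :=
    (integrable_const 1).indicator hBm
  rw [h1]
  set G : Ω → ℝ := fun ω => (7 * η * c + Real.exp (c / 2) * δ) +
        (1 + 2 * Real.exp (c / 2)) * (B.indicator (fun _ => (1 : ℝ)) ω +
          tailSum η (fun k => X k ω) n / η) +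
        Real.exp (c / 2) * tailSum η (fun k => X k ω) n with hG
  have hi1 : Integrable (fun ω => (1 + 2 * Real.exp (c / 2)) *
      (B.indicator (fun _ => (1 : ℝ)) ω + tailSum η (fun k => X k ω) n / η)) μ :=
    (hBi.add (hR.div_const η)).const_mul _
  have hi2 : Integrable (fun ω => (7 * η * c + Real.exp (c / 2) * δ) +
        (1 + 2 * Real.exp (c / 2)) * (B.indicator (fun _ => (1 : ℝ)) ω +
          tailSum η (fun k => X k ω) n / η)) μ := (integrable_const _).add hi1
  have hi3 : Integrable (fun ω => Real.exp (c / 2) * tailSum η (fun k => X k ω) n) μ :=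
    hR.const_mul _
  have hGi : Integrable G μ := hi2.add hi3
  refine (norm_integral_le_of_norm_le hGi (.of_forall fun ω => ?_)).trans (le_of_eq ?_)
  · have := norm_exp_sub_stoppedProd_mul_exp_le (x := fun k => X k ω) (n := n) hv hη0 hη hδ0 hc
      (ω ∈ B) (fun h => (not_le.1 h).le)
    simpa only [hG, Set.indicator_apply] using this
  · simp only [hG]
    rw [integral_add hi2 hi3, integral_add (integrable_const _) hi1, integral_const_mul,
      integral_const_mul, integral_add hBi (hR.div_const η), integral_div,
      integral_indicator_const _ hBm]
    simp

end Row

/-! ### Truncated and tail moments, and Karamata's estimate. -/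

section Truncation

variable {Ω : Type*} {m : MeasurableSpace Ω} {μ : Measure Ω} [IsProbabilityMeasure μ]
  {X : Ω → ℝ}

omit m in
lemma truncSq_apply (X : Ω → ℝ) (a : ℝ) (ω : Ω) :
    truncSq X a ω = if |X ω| ≤ a then X ω ^ 2 else 0 := by
  classical
  simp [truncSq, Set.indicator_apply]

omit m in
lemma truncSq_nonneg (X : Ω → ℝ) (a : ℝ) (ω : Ω) : 0 ≤ truncSq X a ω := by
  rw [truncSq_apply]
  split_ifs <;> positivity

omit m in
lemma truncSq_le_sq (X : Ω → ℝ) (a : ℝ) (ω : Ω) : truncSq X a ω ≤ a ^ 2 := by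
  rw [truncSq_apply]
  split_ifs with h
  · exact sq_le_sq.2 (h.trans (le_abs_self a))
  · positivity

omit m in
lemma truncSq_mono (X : Ω → ℝ) (ω : Ω) : Monotone fun a => truncSq X a ω := by
  intro a b hab
  simp only [truncSq_apply]
  split_ifs with h1 h2
  · exact le_rfl
  · exact absurd (h1.trans hab) h2
  · positivity
  · exact le_rfl

lemma measurable_truncFun (a : ℝ) : Measurable fun x : ℝ => if |x| ≤ a then x ^ 2 else 0 :=
  Measurable.ite (measurableSet_le continuous_abs.measurable measurable_const)
    (measurable_id.pow_const 2) measurable_const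

lemma measurable_truncSq (hX : Measurable X) (a : ℝ) : Measurable (truncSq X a) := by
  have : truncSq X a = (fun x : ℝ => if |x| ≤ a then x ^ 2 else 0) ∘ X := by
    ext ω; simp [truncSq_apply]
  rw [this]
  exact (measurable_truncFun a).comp hX

lemma memLp_truncSq (hX : Measurable X) (a : ℝ) (p : ENNReal) : MemLp (truncSq X a) p μ :=
  MemLp.of_bound (measurable_truncSq hX a).aestronglyMeasurable (a ^ 2) (.of_forall fun ω => by
    rw [Real.norm_of_nonneg (truncSq_nonneg X a ω)]
    exact truncSq_le_sq X a ω)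

lemma integrable_truncSq (hX : Measurable X) (a : ℝ) : Integrable (truncSq X a) μ :=
  memLp_one_iff_integrable.1 (memLp_truncSq hX a 1)

omit [IsProbabilityMeasure μ] in
lemma truncMoment_nonneg (X : Ω → ℝ) (x : ℝ) : 0 ≤ truncMoment μ X x :=
  integral_nonneg fun ω => truncSq_nonneg X x ω

lemma truncMoment_mono (hX : Measurable X) : Monotone (truncMoment μ X) := fun _ _ hab =>
  integral_mono (integrable_truncSq hX _) (integrable_truncSq hX _)
    fun ω => truncSq_mono X ω hab

omit [IsProbabilityMeasure μ] in
lemma truncMoment_eq_of_identDistrib {Y : Ω → ℝ} (h : IdentDistrib X Y μ μ) (a : ℝ) :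
    truncMoment μ X a = truncMoment μ Y a := by
  have := (h.comp (measurable_truncFun a)).integral_eq
  simpa only [truncMoment, Function.comp_def, ← truncSq_apply] using this

lemma truncMoment_le_mul (hX : Measurable X) (hint : Integrable X μ) {a : ℝ} (ha : 0 ≤ a) :
    truncMoment μ X a ≤ a * ∫ ω, |X ω| ∂μ := by
  rw [← integral_const_mul]
  refine integral_mono (integrable_truncSq hX a) (hint.abs.const_mul a) fun ω => ?_
  simp only [truncSq_apply]
  split_ifs with h
  · rw [← sq_abs, sq]
    exact mul_le_mul_of_nonneg_right h (abs_nonneg _)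
  · positivity

lemma tendsto_truncMoment_atTop (hX : Measurable X)
    (hinf : ∫⁻ ω, ENNReal.ofReal (X ω ^ 2) ∂μ = ⊤) :
    Tendsto (truncMoment μ X) atTop atTop := by
  refine tendsto_atTop_atTop_of_monotone (truncMoment_mono hX) fun b => ?_
  by_contra! hb
  have h1 : Tendsto (fun n : ℕ => ∫⁻ ω, ENNReal.ofReal (truncSq X n ω) ∂μ) atTop
      (𝓝 (∫⁻ ω, ENNReal.ofReal (X ω ^ 2) ∂μ)) := by
    refine lintegral_tendsto_of_tendsto_of_monotone
      (fun n => (measurable_truncSq hX n).ennreal_ofReal.aemeasurable) (.of_forall fun ω => ?_)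
      (.of_forall fun ω => ?_)
    · intro a c hac
      exact ENNReal.ofReal_le_ofReal (truncSq_mono X ω (Nat.cast_le.2 hac))
    · refine tendsto_const_nhds.congr' ?_
      filter_upwards [eventually_ge_atTop ⌈|X ω|⌉₊] with n hn
      rw [truncSq_apply, if_pos (Nat.ceil_le.1 hn)]
  rw [hinf] at h1
  have h2 : (⊤ : ENNReal) ≤ ENNReal.ofReal b := by
    refine le_of_tendsto' h1 fun n => ?_
    rw [← ofReal_integral_eq_lintegral_ofReal (integrable_truncSq hX n)
      (.of_forall fun ω => truncSq_nonneg X n ω)]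
    exact ENNReal.ofReal_le_ofReal (hb n).le
  exact absurd h2 (by simp)

/-- The tail moment `E (|X| I(|X| > x))`. -/
noncomputable def tailMoment (μ : Measure Ω) (X : Ω → ℝ) (x : ℝ) : ℝ :=
  ∫ ω, (if x < |X ω| then |X ω| else 0) ∂μ

lemma measurable_tailFun (a : ℝ) : Measurable fun x : ℝ => if a < |x| then |x| else 0 :=
  Measurable.ite (measurableSet_lt measurable_const continuous_abs.measurable)
    continuous_abs.measurable measurable_const

omit [IsProbabilityMeasure μ] in
lemma integrable_tail (hint : Integrable X μ) (a : ℝ) :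
    Integrable (fun ω => if a < |X ω| then |X ω| else 0) μ := by
  refine hint.abs.mono
    ((measurable_tailFun a).comp_aemeasurable
      hint.aestronglyMeasurable.aemeasurable).aestronglyMeasurable
    (.of_forall fun ω => ?_)
  split_ifs <;> simp

omit [IsProbabilityMeasure μ] in
lemma tailMoment_nonneg (X : Ω → ℝ) (x : ℝ) : 0 ≤ tailMoment μ X x :=
  integral_nonneg fun ω => by dsimp only; split_ifs <;> simp

omit [IsProbabilityMeasure μ] in
lemma tailMoment_eq_of_identDistrib {Y : Ω → ℝ} (h : IdentDistrib X Y μ μ) (a : ℝ) :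
    tailMoment μ X a = tailMoment μ Y a :=
  (h.comp (measurable_tailFun a)).integral_eq

omit [IsProbabilityMeasure μ] in
lemma tendsto_tailMoment_zero (hint : Integrable X μ) :
    Tendsto (tailMoment μ X) atTop (𝓝 0) := by
  have : Tendsto (tailMoment μ X) atTop (𝓝 (∫ _, (0 : ℝ) ∂μ)) := by
    refine tendsto_integral_filter_of_dominated_convergence (fun ω => |X ω|)
      (.of_forall fun a => (integrable_tail hint a).aestronglyMeasurable)
      (.of_forall fun a => .of_forall fun ω => ?_) hint.abs (.of_forall fun ω => ?_)
    · split_ifs <;> simp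
    · refine tendsto_const_nhds.congr' ?_
      filter_upwards [eventually_ge_atTop |X ω|] with a ha
      rw [if_neg (not_lt.2 ha)]
  simpa using this

/-- On the shell `x < |X| ≤ 2 x` one has `|X| ≤ X² / x`. This is the dyadic step of Karamata's
theorem. -/
lemma tailMoment_le_add (hX : Measurable X) (hint : Integrable X μ) {x : ℝ} (hx : 0 < x) :
    tailMoment μ X x ≤
      tailMoment μ X (2 * x) + (truncMoment μ X (2 * x) - truncMoment μ X x) / x := by
  have h1 := integrable_truncSq (μ := μ) hX (2 * x)
  have h2 := integrable_truncSq (μ := μ) hX x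
  have h12 : Integrable (fun ω => (truncSq X (2 * x) ω - truncSq X x ω) / x) μ :=
    (h1.sub h2).div_const x
  rw [truncMoment, truncMoment, ← integral_sub h1 h2, ← integral_div, tailMoment, tailMoment,
    ← integral_add (integrable_tail hint _) h12]
  refine integral_mono (integrable_tail hint _) ((integrable_tail hint _).add h12) fun ω => ?_
  simp only [truncSq_apply]
  by_cases ha : |X ω| ≤ x
  · have hb : |X ω| ≤ 2 * x := by linarith
    simp [ha, hb, not_lt.2 ha, not_lt.2 hb]
  · by_cases hb : |X ω| ≤ 2 * x
    · simp only [ha, hb, not_lt.2 hb, not_le.1 ha, if_true, if_false, zero_add, sub_zero]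
      rw [le_div_iff₀ hx, ← sq_abs, sq]
      exact mul_le_mul_of_nonneg_left (not_le.1 ha).le (abs_nonneg _)
    · simp [ha, hb, not_le.1 ha, not_le.1 hb]

lemma mul_measureReal_lt_le_tailMoment (hint : Integrable X μ) (x : ℝ) :
    x * μ.real {ω | x < |X ω|} ≤ tailMoment μ X x := by
  have hnn : 0 ≤ᵐ[μ] fun ω => if x < |X ω| then |X ω| else 0 :=
    .of_forall fun ω => by dsimp only; split_ifs <;> simp
  by_cases hx : 0 < x
  · refine le_trans ?_ (mul_meas_ge_le_integral_of_nonneg hnn (integrable_tail hint x) x)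
    refine mul_le_mul_of_nonneg_left (measureReal_mono fun ω hω => ?_) hx.le
    simp only [Set.mem_ofPred_eq] at hω ⊢
    rw [if_pos hω]
    exact hω.le
  · have := tailMoment_nonneg (μ := μ) X x
    have h2 : 0 ≤ μ.real {ω | x < |X ω|} := measureReal_nonneg
    nlinarith

/-- Karamata's theorem for the tail moment: `x T(x) / H(x) → 0` when `H` is slowly varying. -/
lemma tendsto_mul_tailMoment_div_truncMoment (hX : Measurable X) (hint : Integrable X μ)
    (hDA : SlowlyVarying (truncMoment μ X)) :
    Tendsto (fun x => x * tailMoment μ X x / truncMoment μ X x) atTop (𝓝 0) := by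
  set H := truncMoment μ X with hH
  set T := tailMoment μ X with hT
  obtain ⟨-, hpos, hsv⟩ := hDA
  rw [Metric.tendsto_nhds]
  intro ε hε
  -- With `δ ≤ 1 / 2`, doubling the argument multiplies `H` by at most `3 / 2`, so `H(y) / y`
  -- shrinks by `3 / 4` and the shells sum to at most `4 δ H(x) / x`; `δ ≤ ε / 8` makes `4 δ < ε`.
  set δ := min (ε / 8) (1 / 2) with hδ
  have hδ0 : 0 < δ := by positivity
  have hδ1 : δ ≤ 1 / 2 := min_le_right _ _
  have hδε : δ ≤ ε / 8 := min_le_left _ _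
  have hev : ∀ᶠ x in atTop, 0 < H x ∧ H (2 * x) ≤ (1 + δ) * H x := by
    filter_upwards [hpos, (hsv 2 two_pos).eventually
      (gt_mem_nhds (show (1 : ℝ) < 1 + δ by linarith))] with x h1 h2
    exact ⟨h1, ((div_lt_iff₀ h1).1 h2).le⟩
  obtain ⟨x₀, hx₀⟩ := eventually_atTop.1 hev
  filter_upwards [eventually_ge_atTop x₀, eventually_gt_atTop 0] with x hx hx0
  have hHx := (hx₀ x hx).1
  have hge : ∀ N : ℕ, x₀ ≤ 2 ^ N * x := fun N =>
    hx.trans (le_mul_of_one_le_left hx0.le (one_le_pow₀ (by norm_num)))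
  have hgrow : ∀ N : ℕ, H (2 ^ N * x) ≤ (3 / 2) ^ N * H x := by
    intro N
    induction N with
    | zero => simp
    | succ N ih =>
      have h1 := (hx₀ _ (hge N))
      rw [pow_succ', mul_assoc]
      calc _ ≤ (1 + δ) * H (2 ^ N * x) := h1.2
        _ ≤ (3 / 2) * H (2 ^ N * x) := mul_le_mul_of_nonneg_right (by linarith) h1.1.le
        _ ≤ (3 / 2) * ((3 / 2) ^ N * H x) := by gcongr
        _ = _ := by ring
  have hstep : ∀ N : ℕ, T x ≤ T (2 ^ N * x) + 4 * δ * (H x / x) * (1 - (3 / 4) ^ N) := by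
    intro N
    induction N with
    | zero => simp
    | succ N ih =>
      have h1 := tailMoment_le_add (μ := μ) hX hint (x := 2 ^ N * x) (by positivity)
      have h2 := (hx₀ _ (hge N)).2
      have h3 : (H (2 * (2 ^ N * x)) - H (2 ^ N * x)) / (2 ^ N * x) ≤
          δ * (H x / x) * (3 / 4) ^ N := by
        rw [div_le_iff₀ (by positivity)]
        calc _ ≤ δ * H (2 ^ N * x) := by linarith
          _ ≤ δ * ((3 / 2) ^ N * H x) := by gcongr; exact hgrow N
          _ = δ * (((3 / 4) ^ N * 2 ^ N) * H x) := by rw [← mul_pow]; norm_num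
          _ = _ := by field_simp
      have h4 : T (2 ^ (N + 1) * x) = T (2 * (2 ^ N * x)) := by rw [pow_succ', mul_assoc]
      rw [h4]
      calc _ ≤ _ := ih
        _ ≤ (T (2 * (2 ^ N * x)) + δ * (H x / x) * (3 / 4) ^ N) +
            4 * δ * (H x / x) * (1 - (3 / 4) ^ N) := by
            gcongr
            exact h1.trans (by gcongr)
        _ = _ := by ring
  have hlim : T x ≤ 4 * δ * (H x / x) := by
    have h1 : Tendsto (fun N : ℕ => T (2 ^ N * x)) atTop (𝓝 0) :=
      (tendsto_tailMoment_zero hint).comp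
        ((tendsto_pow_atTop_atTop_of_one_lt (by norm_num)).atTop_mul_const hx0)
    have h2 : Tendsto (fun N : ℕ => T (2 ^ N * x) + 4 * δ * (H x / x)) atTop
        (𝓝 (0 + 4 * δ * (H x / x))) := h1.add_const _
    rw [zero_add] at h2
    refine ge_of_tendsto' h2 fun N => (hstep N).trans (add_le_add le_rfl ?_)
    have h3 : 0 ≤ 4 * δ * (H x / x) := by positivity
    refine mul_le_of_le_one_right h3 ?_
    have : (0 : ℝ) ≤ (3 / 4) ^ N := by positivity
    linarith
  have hT0 : 0 ≤ T x := tailMoment_nonneg X x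
  rw [Real.dist_eq, sub_zero, abs_of_nonneg (by positivity), div_lt_iff₀ hHx]
  calc x * T x ≤ x * (4 * δ * (H x / x)) := by gcongr
    _ = 4 * δ * H x := by field_simp
    _ < ε * H x := by
        refine mul_lt_mul_of_pos_right ?_ hHx
        linarith

end Truncation

/-! ### The normalizer `D_n` and its asymptotics. -/

section Normalizer

variable {Ω : Type*} {m : MeasurableSpace Ω} {μ : Measure Ω} [IsProbabilityMeasure μ]
  {X : Ω → ℝ}

lemma modMoment_mono (hX : Measurable X) : Monotone (modMoment μ X) := fun _ _ hab =>
  truncMoment_mono hX (max_le_max_right _ hab)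

/-- The shift `b + 1` lies strictly above the infimum, so some point of the defining set lies below
it; infinite variance makes that set nonempty. -/
lemma one_le_modMoment (hX : Measurable X)
    (hinf : ∫⁻ ω, ENNReal.ofReal (X ω ^ 2) ∂μ = ⊤) (s : ℝ) : 1 ≤ modMoment μ X s := by
  obtain ⟨y, hy0, hy⟩ := ((eventually_ge_atTop 0).and
    ((tendsto_truncMoment_atTop hX hinf).eventually_gt_atTop 1)).exists
  have hne : {x : ℝ | 0 ≤ x ∧ 1 < truncMoment μ X x}.Nonempty := ⟨y, hy0, hy⟩
  obtain ⟨x, hx, hxlt⟩ := exists_lt_of_csInf_lt hne (lt_add_one (cutLevel μ X))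
  exact hx.2.le.trans (truncMoment_mono hX (hxlt.le.trans (le_max_right _ _)))

/-- Since `H_0(s) ≤ s E|X|`, every large enough `s ≥ n E|X|` belongs to the set. -/
lemma normalizer_set_nonempty (hX : Measurable X) (hint : Integrable X μ) (n : ℕ) :
    {s : ℝ | 1 ≤ s ∧ (n : ℝ) / s ^ 2 * modMoment μ X s ≤ 1}.Nonempty := by
  set E := ∫ ω, |X ω| ∂μ
  set s := max (max 1 (cutLevel μ X + 1)) (n * E) with hs
  have h1 : 1 ≤ s := (le_max_left _ _).trans (le_max_left _ _)
  have h2 : cutLevel μ X + 1 ≤ s := (le_max_right _ _).trans (le_max_left _ _)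
  have h3 : n * E ≤ s := le_max_right _ _
  refine ⟨s, h1, ?_⟩
  rw [modMoment, max_eq_left h2, div_mul_eq_mul_div, div_le_one (by positivity)]
  have h4 := truncMoment_le_mul (μ := μ) hX hint (zero_le_one.trans h1)
  calc _ ≤ n * (s * E) := by gcongr
    _ = s * (n * E) := by ring
    _ ≤ s * s := by gcongr
    _ = _ := by ring

lemma one_le_normalizer (hX : Measurable X) (hint : Integrable X μ) (n : ℕ) :
    1 ≤ normalizer μ X n :=
  le_csInf (normalizer_set_nonempty hX hint n) fun _ hs => hs.1

/-- Equality holds even if `H` jumps: `H` is monotone and `s²` continuous, so points of the set just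
right of `D` give `≤` and points left of `D`, all outside the set, give `≥`. -/
lemma mul_modMoment_normalizer (hX : Measurable X) (hint : Integrable X μ)
    (hinf : ∫⁻ ω, ENNReal.ofReal (X ω ^ 2) ∂μ = ⊤) {n : ℕ} (hn : 2 ≤ n) :
    n * modMoment μ X (normalizer μ X n) = normalizer μ X n ^ 2 := by
  set D := normalizer μ X n with hD
  have hD1 : 1 ≤ D := one_le_normalizer hX hint n
  have hn' : (2 : ℝ) ≤ n := by exact_mod_cast hn
  have hbdd : BddBelow {s : ℝ | 1 ≤ s ∧ (n : ℝ) / s ^ 2 * modMoment μ X s ≤ 1} :=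
    ⟨1, fun _ hs => hs.1⟩
  have hle : n * modMoment μ X D ≤ D ^ 2 := by
    have hc : Tendsto (fun s : ℝ => s ^ 2) (𝓝[>] D) (𝓝 (D ^ 2)) :=
      ((continuous_pow 2).tendsto D).mono_left nhdsWithin_le_nhds
    refine ge_of_tendsto hc ?_
    filter_upwards [self_mem_nhdsWithin] with s hs
    obtain ⟨r, ⟨hr1, hr⟩, hrs⟩ := exists_lt_of_csInf_lt (normalizer_set_nonempty hX hint n) hs
    have hDr : D ≤ r := csInf_le hbdd ⟨hr1, hr⟩
    rw [div_mul_eq_mul_div, div_le_one (by positivity)] at hr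
    have := modMoment_mono (μ := μ) hX hDr
    calc _ ≤ n * modMoment μ X r := by gcongr
      _ ≤ r ^ 2 := hr
      _ ≤ s ^ 2 := by gcongr
  -- This is where `2 ≤ n` enters: `D² ≥ n H(D) ≥ 2`, which leaves room in `(1, D)` for the left
  -- limit.
  have hgt : 1 < D := by
    have := one_le_modMoment hX hinf D
    nlinarith
  refine le_antisymm hle ?_
  have hc : Tendsto (fun s : ℝ => s ^ 2) (𝓝[<] D) (𝓝 (D ^ 2)) :=
    ((continuous_pow 2).tendsto D).mono_left nhdsWithin_le_nhds
  refine le_of_tendsto hc ?_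
  filter_upwards [Ioo_mem_nhdsLT hgt] with s hs
  have h1 : ¬ ((n : ℝ) / s ^ 2 * modMoment μ X s ≤ 1) := fun h =>
    absurd (csInf_le hbdd ⟨hs.1.le, h⟩) (not_le.2 hs.2)
  have hs0 : 0 < s := by linarith [hs.1]
  rw [div_mul_eq_mul_div, div_le_one (by positivity), not_le] at h1
  have := modMoment_mono (μ := μ) hX hs.2.le
  calc _ ≤ n * modMoment μ X s := h1.le
    _ ≤ _ := by gcongr

lemma tendsto_normalizer_atTop (hX : Measurable X) (hint : Integrable X μ)
    (hinf : ∫⁻ ω, ENNReal.ofReal (X ω ^ 2) ∂μ = ⊤) :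
    Tendsto (normalizer μ X) atTop atTop := by
  have h1 : Tendsto (fun n : ℕ => √(n : ℝ)) atTop atTop :=
    Real.tendsto_sqrt_atTop.comp tendsto_natCast_atTop_atTop
  refine tendsto_atTop_mono' _ ?_ h1
  filter_upwards [eventually_ge_atTop 2] with n hn
  have h2 := mul_modMoment_normalizer hX hint hinf hn
  have h3 := one_le_modMoment hX hinf (normalizer μ X n)
  have h4 := one_le_normalizer (μ := μ) hX hint n
  rw [Real.sqrt_le_left (by linarith), ← h2]
  exact le_mul_of_one_le_right (Nat.cast_nonneg n) h3

lemma eventually_mul_truncMoment_normalizer (hX : Measurable X) (hint : Integrable X μ)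
    (hinf : ∫⁻ ω, ENNReal.ofReal (X ω ^ 2) ∂μ = ⊤) :
    ∀ᶠ n : ℕ in atTop,
      n * truncMoment μ X (normalizer μ X n) = normalizer μ X n ^ 2 := by
  filter_upwards [eventually_ge_atTop 2,
    (tendsto_normalizer_atTop hX hint hinf).eventually_ge_atTop (cutLevel μ X + 1)] with n hn hD
  have := mul_modMoment_normalizer hX hint hinf hn
  rwa [modMoment, max_eq_left hD] at this

/-- Substituting `D_n² = n H_0(D_n)` turns the quotient into `H_0(c D_n) / H_0(D_n)`. -/
lemma tendsto_mul_truncMoment_div_sq (hX : Measurable X) (hint : Integrable X μ)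
    (hinf : ∫⁻ ω, ENNReal.ofReal (X ω ^ 2) ∂μ = ⊤)
    (hDA : SlowlyVarying (truncMoment μ X)) {c : ℝ} (hc : 0 < c) :
    Tendsto (fun n : ℕ => n * truncMoment μ X (c * normalizer μ X n) / normalizer μ X n ^ 2)
      atTop (𝓝 1) := by
  have hDt := tendsto_normalizer_atTop hX hint hinf
  refine ((hDA.2.2 c hc).comp hDt).congr' ?_
  filter_upwards [eventually_mul_truncMoment_normalizer hX hint hinf,
    hDt.eventually hDA.2.1, eventually_gt_atTop 0] with n h1 h2 hn
  have hn' : (0 : ℝ) < n := by exact_mod_cast hn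
  simp only [Function.comp_apply]
  rw [← h1, mul_div_mul_left _ _ hn'.ne']

lemma tendsto_mul_tailMoment_div (hX : Measurable X) (hint : Integrable X μ)
    (hinf : ∫⁻ ω, ENNReal.ofReal (X ω ^ 2) ∂μ = ⊤)
    (hDA : SlowlyVarying (truncMoment μ X)) {c : ℝ} (hc : 0 < c) :
    Tendsto (fun n : ℕ => n * tailMoment μ X (c * normalizer μ X n) / normalizer μ X n)
      atTop (𝓝 0) := by
  have hDt := tendsto_normalizer_atTop hX hint hinf
  have hcD : Tendsto (fun n => c * normalizer μ X n) atTop atTop := hDt.const_mul_atTop hc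
  have h := (((tendsto_mul_tailMoment_div_truncMoment hX hint hDA).comp hcD).mul
    (tendsto_mul_truncMoment_div_sq hX hint hinf hDA hc)).div_const c
  rw [zero_mul, zero_div] at h
  refine h.congr' ?_
  filter_upwards [hcD.eventually hDA.2.1, hDt.eventually_gt_atTop 0] with n h1 h2
  simp only [Function.comp_apply]
  field_simp

lemma tendsto_mul_measureReal_lt (hX : Measurable X) (hint : Integrable X μ)
    (hinf : ∫⁻ ω, ENNReal.ofReal (X ω ^ 2) ∂μ = ⊤)
    (hDA : SlowlyVarying (truncMoment μ X)) {c : ℝ} (hc : 0 < c) :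
    Tendsto (fun n : ℕ => n * μ.real {ω | c * normalizer μ X n < |X ω|}) atTop (𝓝 0) := by
  have h := (tendsto_mul_tailMoment_div hX hint hinf hDA hc).div_const c
  rw [zero_div] at h
  refine squeeze_zero (fun n => by positivity) (fun n => ?_) h
  have hD := one_le_normalizer (μ := μ) hX hint n
  have h1 := mul_measureReal_lt_le_tailMoment hint (c * normalizer μ X n)
  have hD0 : 0 < normalizer μ X n := by linarith
  rw [div_div, le_div_iff₀ (by positivity)]
  calc _ = n * (c * normalizer μ X n * μ.real {ω | c * normalizer μ X n < |X ω|}) := by ring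
    _ ≤ _ := by gcongr

end Normalizer

/-! ### Covariance decay and the weak law for the squares. -/

section Mixing

variable {Ω : Type*} {m : MeasurableSpace Ω} {μ : Measure Ω} [IsProbabilityMeasure μ]
  {ξ : ℤ → Ω → ℝ}

/-- Each lag occurs at most twice, once on either side of `i`. -/
lemma sum_Icc_natAbs_le {C : ℕ → ℝ} (hC : ∀ k, 0 ≤ C k) {n : ℕ} {i : ℤ}
    (hi : i ∈ Finset.Icc (1 : ℤ) n) :
    ∑ j ∈ Finset.Icc (1 : ℤ) n, C (j - i).natAbs ≤ 2 * ∑ k ∈ Finset.range n, C k := by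
  have key : ∀ s ⊆ Finset.Icc (1 : ℤ) n,
      Set.InjOn (fun j : ℤ => (j - i).natAbs) s →
      ∑ j ∈ s, C (j - i).natAbs ≤ ∑ k ∈ Finset.range n, C k := by
    intro s hs hinj
    rw [← Finset.sum_image (f := C) (g := fun j : ℤ => (j - i).natAbs) hinj]
    refine Finset.sum_le_sum_of_subset_of_nonneg (fun k hk => ?_) fun k _ _ => hC k
    obtain ⟨j, hj, rfl⟩ := Finset.mem_image.1 hk
    have hj := hs hj
    simp only [Finset.mem_Icc, Finset.mem_range] at hi hj ⊢
    omega
  rw [← Finset.sum_filter_add_sum_filter_not _ (fun j => i ≤ j), two_mul]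
  refine add_le_add (key _ (Finset.filter_subset _ _) ?_) (key _ (Finset.filter_subset _ _) ?_)
  · intro a ha b hb hab
    simp only [Finset.coe_filter, Set.mem_ofPred_eq] at ha hb hab
    omega
  · intro a ha b hb hab
    simp only [Finset.coe_filter, Set.mem_ofPred_eq] at ha hb hab
    omega

lemma variance_sum_Icc_le {Z : ℤ → Ω → ℝ} (hZ : ∀ k, MemLp (Z k) 2 μ) {C : ℕ → ℝ}
    (hC : ∀ k, 0 ≤ C k) (hcov : ∀ (j : ℤ) (k : ℕ), cov[Z j, Z (j + k); μ] ≤ C k) (n : ℕ) :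
    Var[fun ω => ∑ k ∈ Finset.Icc (1 : ℤ) n, Z k ω; μ] ≤
      n * (2 * ∑ k ∈ Finset.range n, C k) := by
  rw [variance_fun_sum' fun k _ => hZ k]
  have h : ∀ i ∈ Finset.Icc (1 : ℤ) n, ∑ j ∈ Finset.Icc (1 : ℤ) n, cov[Z i, Z j; μ] ≤
      2 * ∑ k ∈ Finset.range n, C k := by
    intro i hi
    refine (Finset.sum_le_sum fun j _ => ?_).trans (sum_Icc_natAbs_le hC hi)
    rcases le_total i j with hij | hij
    · have := hcov i (j - i).natAbs
      rwa [show i + ((j - i).natAbs : ℤ) = j by omega] at this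
    · have := hcov j (j - i).natAbs
      rwa [show j + ((j - i).natAbs : ℤ) = i by omega, covariance_comm] at this
  refine (Finset.sum_le_card_nsmul _ _ _ h).trans (le_of_eq ?_)
  simp

lemma covariance_truncSq_self_le {X : Ω → ℝ} (hX : Measurable X) (a : ℝ) :
    cov[truncSq X a, truncSq X a; μ] ≤ a ^ 2 * truncMoment μ X a := by
  rw [covariance_self (measurable_truncSq hX a).aemeasurable]
  refine (variance_le_expectation_sq (measurable_truncSq hX a).aestronglyMeasurable).trans ?_
  rw [truncMoment, ← integral_const_mul]
  refine integral_mono (memLp_truncSq hX a 2).integrable_sq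
    ((integrable_truncSq hX a).const_mul _) fun ω => ?_
  simp only [Pi.pow_apply, sq (truncSq X a ω)]
  exact mul_le_mul_of_nonneg_right (truncSq_le_sq X a ω) (truncSq_nonneg X a ω)

/-- The common consequence of the conditions `MixingOne` and `MixingTwo` on which the law of large
numbers for the squares rests. -/
def CovarianceDecay (μ : Measure Ω) (ξ : ℤ → Ω → ℝ) : Prop :=
  ∃ φ ψ : ℕ → ℝ, (∀ k, 0 ≤ φ k) ∧ (∀ k, 0 ≤ ψ k) ∧ Summable φ ∧ Tendsto ψ atTop (𝓝 0) ∧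
    ∀ a : ℝ, 0 < a → ∀ (j : ℤ) (k : ℕ),
      cov[truncSq (ξ j) a, truncSq (ξ (j + k)) a; μ] ≤
        a ^ 2 * truncMoment μ (ξ 0) a * φ k + truncMoment μ (ξ 0) a ^ 2 * ψ k

lemma covarianceDecay_of_mixing (hmeas : ∀ k, Measurable (ξ k))
    (hident : ∀ k, IdentDistrib (ξ k) (ξ 0) μ μ) (h : MixingOne μ ξ ∨ MixingTwo μ ξ) :
    CovarianceDecay μ ξ := by
  have hzero : ∀ (a : ℝ) (j : ℤ), cov[truncSq (ξ j) a, truncSq (ξ (j + (0 : ℕ))) a; μ] ≤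
      a ^ 2 * truncMoment μ (ξ 0) a := by
    intro a j
    have := covariance_truncSq_self_le (μ := μ) (hmeas j) a
    rw [truncMoment_eq_of_identDistrib (hident j)] at this
    simpa using this
  rcases h with ⟨ψ, hψ0, hψ, hcov⟩ | ⟨φ, hφ0, hφ, hcov⟩
  -- The mixing conditions say nothing at lag 0, so the variance term is carried by setting `φ 0 =
  -- 1`; the second case does the same.
  · refine ⟨Pi.single 0 1, ψ, fun k => ?_, fun k => (hψ0 k).le, ?_, hψ, fun a ha j k => ?_⟩
    · by_cases hk : k = 0 <;> simp [hk]
    · exact summable_of_hasFiniteSupport ((Set.finite_singleton 0).subset (by simp))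
    · rcases Nat.eq_zero_or_pos k with rfl | hk
      · have h1 := hzero a j
        have h2 := mul_nonneg (sq_nonneg (truncMoment μ (ξ 0) a)) (hψ0 0).le
        simp only [Pi.single_eq_same, mul_one]
        linarith
      · rw [Pi.single_eq_of_ne hk.ne']
        refine (hcov a a ha ha j k hk).trans (le_of_eq ?_)
        ring
  · refine ⟨fun k => if k = 0 then 1 else φ k, 0, fun k => ?_, fun k => le_rfl, ?_,
      tendsto_const_nhds, fun a ha j k => ?_⟩
    · dsimp only
      split_ifs
      · exact zero_le_one
      · exact (hφ0 k).le
    · refine (summable_congr_cofinite ?_).2 hφ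
      filter_upwards [(Set.finite_singleton 0).compl_mem_cofinite] with k hk
      exact if_neg hk
    · rcases Nat.eq_zero_or_pos k with rfl | hk
      · simpa using hzero a j
      · simp only [hk.ne', if_false, Pi.zero_apply, mul_zero, add_zero]
        refine (hcov a a ha ha j k hk).trans (le_of_eq ?_)
        ring

lemma measureReal_le_abs_sum_truncSq_sub_le (hmeas : ∀ k, Measurable (ξ k))
    (hident : ∀ k, IdentDistrib (ξ k) (ξ 0) μ μ) {C : ℕ → ℝ} (hC : ∀ k, 0 ≤ C k) {a : ℝ}
    (hcov : ∀ (j : ℤ) (k : ℕ), cov[truncSq (ξ j) a, truncSq (ξ (j + k)) a; μ] ≤ C k)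
    (n : ℕ) {r : ℝ} (hr : 0 < r) :
    μ.real {ω | r ≤ |∑ k ∈ Finset.Icc (1 : ℤ) n, truncSq (ξ k) a ω -
        n * truncMoment μ (ξ 0) a|} ≤
      n * (2 * ∑ k ∈ Finset.range n, C k) / r ^ 2 := by
  have hZ : ∀ k, MemLp (truncSq (ξ k) a) 2 μ := fun k => memLp_truncSq (hmeas k) a 2
  have hS : MemLp (fun ω => ∑ k ∈ Finset.Icc (1 : ℤ) n, truncSq (ξ k) a ω) 2 μ :=
    memLp_finsetSum _ fun k _ => hZ k
  have hmean : ∫ ω, ∑ k ∈ Finset.Icc (1 : ℤ) n, truncSq (ξ k) a ω ∂μ =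
      n * truncMoment μ (ξ 0) a := by
    rw [integral_finsetSum _ fun k _ => integrable_truncSq (hmeas k) a]
    have : ∀ k ∈ Finset.Icc (1 : ℤ) n, ∫ ω, truncSq (ξ k) a ω ∂μ = truncMoment μ (ξ 0) a :=
      fun k _ => truncMoment_eq_of_identDistrib (hident k) a
    rw [Finset.sum_congr rfl this]
    simp
  have hch := meas_ge_le_variance_div_sq hS hr
  rw [hmean] at hch
  refine (ENNReal.toReal_le_of_le_ofReal
    (div_nonneg (variance_nonneg _ _) (sq_nonneg r)) hch).trans ?_
  gcongr
  exact variance_sum_Icc_le hZ hC hcov n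

omit [IsProbabilityMeasure μ] in
lemma measureReal_exists_lt_abs_le (hident : ∀ k, IdentDistrib (ξ k) (ξ 0) μ μ) (n : ℕ) (a : ℝ) :
    μ.real (⋃ k ∈ Finset.Icc (1 : ℤ) n, {ω | a < |ξ k ω|}) ≤ n * μ.real {ω | a < |ξ 0 ω|} := by
  have hset : MeasurableSet {x : ℝ | a < |x|} :=
    measurableSet_lt measurable_const continuous_abs.measurable
  have h : ∀ k ∈ Finset.Icc (1 : ℤ) n, μ.real {ω | a < |ξ k ω|} = μ.real {ω | a < |ξ 0 ω|} :=
    fun k _ => congrArg ENNReal.toReal ((hident k).measure_mem_eq hset)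
  refine (measureReal_biUnion_finset_le _ _).trans (le_of_eq ?_)
  rw [Finset.sum_congr rfl h]
  simp

/-- The law of large numbers for the squares under decay of the covariances. -/
lemma squaresConverge_of_covarianceDecay (hmeas : ∀ k, Measurable (ξ k))
    (hint : Integrable (ξ 0) μ) (hident : ∀ k, IdentDistrib (ξ k) (ξ 0) μ μ)
    (hinf : ∫⁻ ω, ENNReal.ofReal (ξ 0 ω ^ 2) ∂μ = ⊤)
    (hDA : SlowlyVarying (truncMoment μ (ξ 0))) (h : CovarianceDecay μ ξ) :
    SquaresConverge μ ξ := by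
  obtain ⟨φ, ψ, hφ0, hψ0, hφ, hψ, hcov⟩ := h
  rw [SquaresConverge, tendstoInMeasure_iff_measureReal_norm]
  intro δ hδ
  rw [Metric.tendsto_nhds]
  intro γ hγ
  set Φ := ∑' k, φ k with hΦ
  have hΦ0 : 0 ≤ Φ := tsum_nonneg hφ0
  -- Truncating at `ε D_n` gives the `φ` part of the Chebyshev bound the limit `8 ε² Φ / δ²`, which
  -- this choice makes less than `γ / 2`; `Φ + 1` avoids dividing by zero.
  set ε := √(γ * δ ^ 2 / (16 * (Φ + 1))) with hε
  have hε0 : 0 < ε := Real.sqrt_pos.2 (by positivity)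
  have hεsq : ε ^ 2 = γ * δ ^ 2 / (16 * (Φ + 1)) := Real.sq_sqrt (by positivity)
  set D := normalizer μ (ξ 0) with hD
  set u : ℕ → ℝ := fun n => n * truncMoment μ (ξ 0) (ε * D n) / D n ^ 2 with hu
  have hu1 : Tendsto u atTop (𝓝 1) := tendsto_mul_truncMoment_div_sq (hmeas 0) hint hinf hDA hε0
  have hP := tendsto_mul_measureReal_lt (hmeas 0) hint hinf hDA hε0
  -- `ψ` need not be summable: the sum of its first `n` values is `o(n)`, and that suffices because
  -- `(n H_0(ε D_n))²` is of order `D_n⁴`.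
  have hcz := hψ.cesaro
  set c : ℕ → ℝ := fun n => (n : ℝ)⁻¹ * ∑ k ∈ Finset.range n, ψ k with hc
  have hlim : Tendsto (fun n : ℕ => n * μ.real {ω | ε * D n < |ξ 0 ω|} +
      (2 * ε ^ 2 * Φ * u n + 2 * u n ^ 2 * c n) / (δ / 2) ^ 2) atTop
      (𝓝 (0 + (2 * ε ^ 2 * Φ * 1 + 2 * 1 ^ 2 * 0) / (δ / 2) ^ 2)) :=
    hP.add (((hu1.const_mul _).add (((hu1.pow 2).const_mul 2).mul hcz)).div_const _)
  have hlt : 0 + (2 * ε ^ 2 * Φ * 1 + 2 * 1 ^ 2 * 0) / (δ / 2) ^ 2 < γ := by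
    have h1 : 0 + (2 * ε ^ 2 * Φ * 1 + 2 * 1 ^ 2 * 0) / (δ / 2) ^ 2 =
        γ * (Φ / (2 * (Φ + 1))) := by
      rw [hεsq]
      field_simp
      ring
    rw [h1]
    refine mul_lt_of_lt_one_right hγ ?_
    rw [div_lt_one (by positivity)]
    linarith
  filter_upwards [hlim.eventually (gt_mem_nhds hlt),
    hu1.eventually (Metric.ball_mem_nhds 1 (half_pos hδ)), eventually_gt_atTop 0] with n h1 h2 hn
  have hn' : (0 : ℝ) < n := by exact_mod_cast hn
  have hDn : 0 < D n := zero_lt_one.trans_le (one_le_normalizer (hmeas 0) hint n)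
  rw [Real.dist_eq, sub_zero, abs_of_nonneg measureReal_nonneg]
  refine lt_of_le_of_lt ?_ h1
  set a := ε * D n with ha
  have ha0 : 0 < a := by positivity
  set hh := truncMoment μ (ξ 0) a with hhh
  have hh0 : 0 ≤ hh := truncMoment_nonneg _ _
  set C : ℕ → ℝ := fun k => a ^ 2 * hh * φ k + hh ^ 2 * ψ k with hCdef
  have hC0 : ∀ k, 0 ≤ C k := fun k =>
    add_nonneg (mul_nonneg (by positivity) (hφ0 k)) (mul_nonneg (by positivity) (hψ0 k))
  have hr : 0 < δ / 2 * D n ^ 2 := by positivity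
  have hcheb := measureReal_le_abs_sum_truncSq_sub_le hmeas hident hC0 (hcov a ha0) n hr
  -- If no variable exceeds `a`, truncation changes nothing; half of `δ` is for the fluctuation and
  -- half for the bias `u n - 1`.
  have hsub : {ω | δ ≤ ‖1 / D n ^ 2 * ∑ k ∈ Finset.Icc (1 : ℤ) n, ξ k ω ^ 2 - 1‖} ⊆
      (⋃ k ∈ Finset.Icc (1 : ℤ) n, {ω | a < |ξ k ω|}) ∪
      {ω | δ / 2 * D n ^ 2 ≤ |∑ k ∈ Finset.Icc (1 : ℤ) n, truncSq (ξ k) a ω - n * hh|} := by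
    intro ω hω
    by_contra hcon
    simp only [Set.mem_union, Set.mem_iUnion, Set.mem_ofPred_eq, not_or, not_exists, not_lt,
      not_le] at hcon hω
    obtain ⟨hc1, hc2⟩ := hcon
    have heq : ∑ k ∈ Finset.Icc (1 : ℤ) n, truncSq (ξ k) a ω =
        ∑ k ∈ Finset.Icc (1 : ℤ) n, ξ k ω ^ 2 :=
      Finset.sum_congr rfl fun k hk => by rw [truncSq_apply, if_pos (hc1 k hk)]
    rw [heq] at hc2
    have h3 : 1 / D n ^ 2 * ∑ k ∈ Finset.Icc (1 : ℤ) n, ξ k ω ^ 2 - 1 =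
        (∑ k ∈ Finset.Icc (1 : ℤ) n, ξ k ω ^ 2 - n * hh) / D n ^ 2 + (u n - 1) := by
      simp only [hu]
      ring
    have h4 : |(∑ k ∈ Finset.Icc (1 : ℤ) n, ξ k ω ^ 2 - n * hh) / D n ^ 2| < δ / 2 := by
      rw [abs_div, abs_of_pos (show 0 < D n ^ 2 by positivity), div_lt_iff₀ (by positivity)]
      exact hc2
    have h5 : |u n - 1| < δ / 2 := h2
    rw [h3, Real.norm_eq_abs] at hω
    have := abs_add_le ((∑ k ∈ Finset.Icc (1 : ℤ) n, ξ k ω ^ 2 - n * hh) / D n ^ 2) (u n - 1)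
    linarith
  have hsumφ : ∑ k ∈ Finset.range n, φ k ≤ Φ := hφ.sum_le_tsum _ fun k _ => hφ0 k
  have hsumψ : ∑ k ∈ Finset.range n, ψ k = n * c n := by
    simp only [hc]
    field_simp
  have hcheb2 : n * (2 * ∑ k ∈ Finset.range n, C k) / (δ / 2 * D n ^ 2) ^ 2 ≤
      (2 * ε ^ 2 * Φ * u n + 2 * u n ^ 2 * c n) / (δ / 2) ^ 2 := by
    have hsum : ∑ k ∈ Finset.range n, C k ≤ a ^ 2 * hh * Φ + hh ^ 2 * (n * c n) := by
      simp only [hCdef]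
      rw [Finset.sum_add_distrib, ← Finset.mul_sum, ← Finset.mul_sum, hsumψ]
      gcongr
    calc _ ≤ n * (2 * (a ^ 2 * hh * Φ + hh ^ 2 * (n * c n))) / (δ / 2 * D n ^ 2) ^ 2 := by gcongr
      _ = _ := by
        have h6 : u n = n * hh / D n ^ 2 := rfl
        rw [h6, ha]
        field_simp
  refine (measureReal_mono hsub).trans ((measureReal_union_le _ _).trans ?_)
  exact add_le_add (measureReal_exists_lt_abs_le hident n a) (hcheb.trans hcheb2)

end Mixing

/-! ### Convergence of the characteristic functions. -/

section CentralLimit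

variable {Ω : Type*} {m : MeasurableSpace Ω} {μ : Measure Ω} [IsProbabilityMeasure μ]
  {ξ : ℤ → Ω → ℝ}

lemma sum_Icc_one_eq_sum_range (f : ℤ → ℝ) (n : ℕ) :
    ∑ k ∈ Finset.Icc (1 : ℤ) n, f k = ∑ k ∈ Finset.range n, f (k + 1) := by
  refine (Finset.sum_bij (fun (k : ℕ) _ => (k + 1 : ℤ)) ?_ ?_ ?_ ?_).symm
  · intro k hk
    simp only [Finset.mem_range, Finset.mem_Icc] at hk ⊢
    omega
  · intro a _ b _ h
    simpa using h
  · intro b hb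
    simp only [Finset.mem_Icc] at hb
    exact ⟨(b - 1).toNat, by simp only [Finset.mem_range]; omega, by omega⟩
  · intro _ _
    rfl

omit [IsProbabilityMeasure μ] in
lemma integral_tailSum_const_mul (hint : ∀ k, Integrable (ξ k) μ)
    (hident : ∀ k, IdentDistrib (ξ k) (ξ 0) μ μ) {r : ℝ} (hr : r ≠ 0) (η : ℝ) (n : ℕ) :
    ∫ ω, tailSum η (fun k => r * ξ (k + 1) ω) n ∂μ =
      |r| * (n * tailMoment μ (ξ 0) (η / |r|)) := by
  have hr' : 0 < |r| := abs_pos.2 hr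
  have h1 : ∀ (k : ℤ) ω, (if η < |r * ξ k ω| then |r * ξ k ω| else 0) =
      |r| * (if η / |r| < |ξ k ω| then |ξ k ω| else 0) := by
    intro k ω
    rw [abs_mul, mul_ite, mul_zero]
    congr 1
    rw [div_lt_iff₀' hr']
  simp only [tailSum, h1]
  rw [integral_finsetSum _ fun k _ => (integrable_tail (hint _) _).const_mul _]
  simp only [integral_const_mul]
  have h2 : ∀ k ∈ Finset.range n,
      |r| * ∫ ω, (if η / |r| < |ξ (k + 1) ω| then |ξ (k + 1) ω| else 0) ∂μ =
      |r| * tailMoment μ (ξ 0) (η / |r|) :=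
    fun k _ => congrArg _ (tailMoment_eq_of_identDistrib (hident _) _)
  rw [Finset.sum_congr rfl h2]
  simp
  ring

/-- The restriction of a filtration indexed by `ℤ` to nonnegative times. -/
def natFiltration (ℱ : Filtration ℤ m) : Filtration ℕ m where
  seq k := ℱ k
  mono' _ _ h := ℱ.mono (Int.ofNat_le.2 h)
  le' k := ℱ.le k

lemma tendsto_integral_exp {ℱ : Filtration ℤ m} (hmart : IsMartingaleDifference μ ℱ ξ)
    (hident : ∀ k, IdentDistrib (ξ k) (ξ 0) μ μ)
    (hinf : ∫⁻ ω, ENNReal.ofReal (ξ 0 ω ^ 2) ∂μ = ⊤)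
    (hDA : SlowlyVarying (truncMoment μ (ξ 0))) (hsq : SquaresConverge μ ξ) (t : ℝ) :
    Tendsto (fun n : ℕ => ∫ ω, Complex.exp ((t *
      ((∑ k ∈ Finset.Icc (1 : ℤ) n, ξ k ω) / normalizer μ (ξ 0) n) : ℝ) * Complex.I) ∂μ)
      atTop (𝓝 (Real.exp (-t ^ 2 / 2) : ℂ)) := by
  rcases eq_or_ne t 0 with rfl | ht
  · simp
  have hmeas : ∀ k, Measurable (ξ k) := fun k => (hmart.adapted k).mono (ℱ.le k) le_rfl
  have hint := hmart.integrable
  set D := normalizer μ (ξ 0) with hD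
  have hDpos : ∀ n, 0 < D n := fun n =>
    zero_lt_one.trans_le (one_le_normalizer (hmeas 0) (hint 0) n)
  have ht' : 0 < |t| := abs_pos.2 ht
  have ht2 : 0 < t ^ 2 := by positivity
  rw [SquaresConverge, tendstoInMeasure_iff_measureReal_norm] at hsq
  rw [Metric.tendsto_nhds]
  intro γ hγ
  -- With `v = t²` and `δ = η ≤ 1 / 2`, this level satisfies `v + δ ≤ c`. Below, `K` is the
  -- coefficient of `η` in the part of the row bound that does not vanish as `n` grows.
  set c := t ^ 2 + 1 with hc
  set K := 7 * c + Real.exp (c / 2) with hK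
  have hK0 : 0 < K := by positivity
  set η := min (1 / 2) (γ / (2 * K)) with hη
  have hη0 : 0 < η := by positivity
  have hη1 : η ≤ 1 / 2 := min_le_left _ _
  have hηK : K * η < γ := by
    have : η ≤ γ / (2 * K) := min_le_right _ _
    rw [le_div_iff₀ (by positivity)] at this
    linarith
  set p : ℕ → ℝ := fun n => μ.real {ω | η / t ^ 2 ≤
    ‖1 / D n ^ 2 * ∑ k ∈ Finset.Icc (1 : ℤ) n, ξ k ω ^ 2 - 1‖} with hp
  set r : ℕ → ℝ := fun n =>
    |t| * (n * tailMoment μ (ξ 0) (η / |t| * D n) / D n) with hr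
  have hp0 : Tendsto p atTop (𝓝 0) := hsq (η / t ^ 2) (by positivity)
  have hr0 : Tendsto r atTop (𝓝 0) := by
    have := (tendsto_mul_tailMoment_div (hmeas 0) (hint 0) hinf hDA
      (show 0 < η / |t| by positivity)).const_mul |t|
    rwa [mul_zero] at this
  have hlim : Tendsto (fun n => (7 * η * c + Real.exp (c / 2) * η) +
      (1 + 2 * Real.exp (c / 2)) * (p n + r n / η) + Real.exp (c / 2) * r n) atTop
      (𝓝 ((7 * η * c + Real.exp (c / 2) * η) +
        (1 + 2 * Real.exp (c / 2)) * (0 + 0 / η) + Real.exp (c / 2) * 0)) :=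
    (((hp0.add (hr0.div_const η)).const_mul _).const_add _).add (hr0.const_mul _)
  have hlt : (7 * η * c + Real.exp (c / 2) * η) +
        (1 + 2 * Real.exp (c / 2)) * (0 + 0 / η) + Real.exp (c / 2) * 0 < γ := by
    refine lt_of_eq_of_lt ?_ hηK
    rw [hK]
    ring
  filter_upwards [hlim.eventually (gt_mem_nhds hlt)] with n hn
  refine lt_of_le_of_lt ?_ hn
  -- The shift makes `X k` measurable at time `k + 1` and centred given time `k`, as the row bound
  -- requires.
  set X : ℕ → Ω → ℝ := fun k ω => t / D n * ξ (k + 1) ω with hX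
  have hXm : ∀ k, Measurable[natFiltration ℱ (k + 1)] (X k) := fun k => by
    have h := (hmart.adapted (k + 1)).const_mul (t / D n)
    have h2 : natFiltration ℱ (k + 1) = ℱ ((k : ℤ) + 1) := by
      change ℱ ((k + 1 : ℕ) : ℤ) = _
      push_cast
      rfl
    rw [h2]
    exact h
  have hXc : ∀ k, μ[X k | natFiltration ℱ k] =ᵐ[μ] 0 := fun k => by
    have h := hmart.condExp_eq_zero (k + 1)
    rw [add_sub_cancel_right] at h
    have h2 : μ[X k | natFiltration ℱ k] =ᵐ[μ] (t / D n) • μ[ξ (k + 1) | ℱ (k : ℤ)] :=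
      condExp_smul (t / D n) (ξ (k + 1)) (ℱ (k : ℤ))
    filter_upwards [h, h2] with ω h h2
    rw [h2]
    simp [h]
  have hrow := norm_integral_exp_sub_le (μ := μ) hXm (fun k => (hint _).const_mul _) hXc n
    (v := t ^ 2) (c := c) (δ := η) (η := η) ht2.le hη0 hη1 hη0.le (by rw [hc]; linarith)
  have hR : ∫ ω, tailSum η (fun k => X k ω) n ∂μ = r n := by
    have hne : t / D n ≠ 0 := div_ne_zero ht (hDpos n).ne'
    simp only [hX, hr]
    rw [integral_tailSum_const_mul hint hident hne, abs_div, abs_of_pos (hDpos n), ← div_mul]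
    ring
  have hpn : μ.real {ω | η ≤ |∑ k ∈ Finset.range n, X k ω ^ 2 - t ^ 2|} = p n := by
    simp only [hp]
    congr 1
    ext ω
    simp only [Set.mem_ofPred_eq, hX]
    have h1 : ∑ k ∈ Finset.range n, (t / D n * ξ (k + 1) ω) ^ 2 - t ^ 2 =
        t ^ 2 * (1 / D n ^ 2 * ∑ k ∈ Finset.Icc (1 : ℤ) n, ξ k ω ^ 2 - 1) := by
      rw [sum_Icc_one_eq_sum_range fun k => ξ k ω ^ 2, mul_sub, ← mul_assoc, Finset.mul_sum,
        mul_one]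
      congr 1
      refine Finset.sum_congr rfl fun k _ => ?_
      ring
    rw [h1, abs_mul, abs_of_pos ht2, Real.norm_eq_abs, div_le_iff₀' ht2]
  rw [hR, hpn] at hrow
  have hS : ∀ ω, t * ((∑ k ∈ Finset.Icc (1 : ℤ) n, ξ k ω) / D n) =
      ∑ k ∈ Finset.range n, X k ω := by
    intro ω
    simp only [hX]
    rw [sum_Icc_one_eq_sum_range fun k => ξ k ω, ← Finset.mul_sum]
    ring
  rw [dist_eq_norm]
  simp only [hS]
  exact hrow

end CentralLimit

end InfVarMart

theorem mainTheorem10 {Ω : Type*} {m : MeasurableSpace Ω} (μ : Measure Ω)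
    [IsProbabilityMeasure μ] (ℱ : Filtration ℤ m) (ξ : ℤ → Ω → ℝ)
    (hmart : InfVarMart.IsMartingaleDifference μ ℱ ξ)
    (hident : ∀ k, IdentDistrib (ξ k) (ξ 0) μ μ)
    (hinf : ∫⁻ ω, ENNReal.ofReal (ξ 0 ω ^ 2) ∂μ = ⊤)
    (hDA : InfVarMart.SlowlyVarying (InfVarMart.truncMoment μ (ξ 0))) :
    (InfVarMart.SquaresConverge μ ξ →
      TendstoInDistribution
        (fun (n : ℕ) ω =>
          (∑ k ∈ Finset.Icc (1 : ℤ) n, ξ k ω) / InfVarMart.normalizer μ (ξ 0) n)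
        atTop (id : ℝ → ℝ) (fun _ => μ) (gaussianReal 0 1)) ∧
    (InfVarMart.MixingOne μ ξ ∨ InfVarMart.MixingTwo μ ξ → InfVarMart.SquaresConverge μ ξ) := by
  have hmeas : ∀ k, Measurable (ξ k) := fun k => (hmart.adapted k).mono (ℱ.le k) le_rfl
  refine ⟨fun hsq => ?_, fun h =>
    InfVarMart.squaresConverge_of_covarianceDecay hmeas (hmart.integrable 0) hident hinf hDA
      (InfVarMart.covarianceDecay_of_mixing hmeas hident h)⟩
  have hM : ∀ n : ℕ, Measurable fun ω =>
      (∑ k ∈ Finset.Icc (1 : ℤ) n, ξ k ω) / InfVarMart.normalizer μ (ξ 0) n := fun n =>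
    (Finset.measurable_fun_sum _ fun k _ => hmeas k).div_const _
  refine ⟨fun n => (hM n).aemeasurable, aemeasurable_id, ?_⟩
  -- Lévy's continuity theorem reduces convergence in distribution to `tendsto_integral_exp`.
  refine ProbabilityMeasure.tendsto_iff_tendsto_charFun.2 fun t => ?_
  have h := InfVarMart.tendsto_integral_exp hmart hident hinf hDA hsq t
  simp only [ProbabilityMeasure.coe_mk, Measure.map_id, charFun_gaussianReal]
  convert h using 2 with n
  · rw [charFun_apply_real, integral_map (hM n).aemeasurable
      (by fun_prop)]
    simp only [Complex.ofReal_mul]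
  · push_cast
    congr 1
    simp
    ring
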